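/- Let $R$ be a commutative ring with unit. A directed graph $E=(E^0,E^1,r_E,s_E)$ (loops and multiple edges allowed) is finite if $E^0$ and $E^1$ are finite; a sink is a vertex $v$ with $s_E^{-1}(v)=\emptyset$, a source is a vertex $v$ with $r_E^{-1}(v)=\emptyset$, and $v$ is regular if $s_E^{-1}(v)$ is finite and non-empty. The Leavitt path algebra $L_R(E)$ is the universal $R$-algebra generated by pairwise orthogonal idempotents $\{v : v\in E^0\}$ and elements $\{e,e^* : e\in E^1\}$ subject to (1) $s_E(e)e=e=e\,r_E(e)$ and (2) $r_E(e)e^*=e^*=e^*s_E(e)$ for all $e\in E^1$; (3) $e^*e=r_E(e)$ for all $e\in E^1$ and $e^*f=0$ for all $e\neq f$ in $E^1$; (4) $v=\sum_{s_E(e)=v}ee^*$ for every regular vertex $v$. An algebraic Cuntz–Krieger algebra over $R$ is a Leavitt path algebra $L_R(G)$ of a finite graph $G$ with no sinks and no sources. Theorem. If $E$ is a finite graph with no sinks, then there exists a finite graph $G$ with no sinks and no sources such that $L_R(E)$ and $L_R(G)$ are isomorphic as $R$-algebras. Thus $L_R(E)$ is isomorphic to an algebraic Cuntz–Krieger algebra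 over $R$. -/

import Mathlib

universe u v w

/-- A directed graph `(E⁰, E¹, r, s)`; loops and multiple edges are allowed. -/
structure DirectedGraph where
  /-- the vertices `E⁰` -/
  Vertex : Type u
  /-- the edges `E¹` -/
  Edge : Type v
  /-- the source map -/
  s : Edge → Vertex
  /-- the range map -/
  r : Edge → Vertex

namespace DirectedGraph

/-- A graph is finite if it has finitely many vertices and finitely many edges. -/
def IsFinite (E : DirectedGraph.{u, v}) : Prop := Finite E.Vertex ∧ Finite E.Edge

/-- A sink is a vertex that emits no edges. -/
def IsSink (E : DirectedGraph.{u, v}) (a : E.Vertex) : Prop := E.s ⁻¹' {a} = ∅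

/-- A source is a vertex that receives no edges. -/
def IsSource (E : DirectedGraph.{u, v}) (a : E.Vertex) : Prop := E.r ⁻¹' {a} = ∅

/-- A regular vertex is one that emits a finite, non-zero number of edges. -/
def IsRegular (E : DirectedGraph.{u, v}) (a : E.Vertex) : Prop :=
  (E.s ⁻¹' {a}).Finite ∧ (E.s ⁻¹' {a}).Nonempty

/-- `E` has no sinks. -/
def NoSinks (E : DirectedGraph.{u, v}) : Prop := ∀ a, ¬ E.IsSink a

/-- `E` has no sources. -/
def NoSources (E : DirectedGraph.{u, v}) : Prop := ∀ a, ¬ E.IsSource a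

end DirectedGraph

namespace LeavittPathAlgebra

/-- The generators of `L_R(E)`: vertices `v`, edges `e` and ghost edges `e*`. -/
inductive Gen (E : DirectedGraph.{u, v}) : Type (max u v)
  | vertex (a : E.Vertex) : Gen E
  | edge (e : E.Edge) : Gen E
  | ghost (e : E.Edge) : Gen E

/-- The free associative (not necessarily unital) `R`-algebra on the generators: its `R`-basis
is the set of non-empty words in the generators. -/
abbrev Free (R : Type w) [CommRing R] (E : DirectedGraph.{u, v}) : Type (max u v w) :=
  MonoidAlgebra R (FreeSemigroup (Gen E))

variable (R : Type w) [CommRing R] (E : DirectedGraph.{u, v})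

/-- A generator as an element of the free algebra. -/
noncomputable def gen (g : Gen E) : Free R E := MonoidAlgebra.single (FreeSemigroup.of g) 1

/-- The vertex `a` in the free algebra. -/
noncomputable abbrev fv (a : E.Vertex) : Free R E := gen R E (Gen.vertex a)

/-- The edge `e` in the free algebra. -/
noncomputable abbrev fe (e : E.Edge) : Free R E := gen R E (Gen.edge e)

/-- The ghost edge `e*` in the free algebra. -/
noncomputable abbrev fg (e : E.Edge) : Free R E := gen R E (Gen.ghost e)

/-- The defining relations of `L_R(E)`. -/
inductive Rel : Free R E → Free R E → Prop
  | idem (a : E.Vertex) : Rel (fv R E a * fv R E a) (fv R E a)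
  | orth (a b : E.Vertex) (h : a ≠ b) : Rel (fv R E a * fv R E b) 0
  | source_edge (e : E.Edge) : Rel (fv R E (E.s e) * fe R E e) (fe R E e)
  | edge_range (e : E.Edge) : Rel (fe R E e * fv R E (E.r e)) (fe R E e)
  | range_ghost (e : E.Edge) : Rel (fv R E (E.r e) * fg R E e) (fg R E e)
  | ghost_source (e : E.Edge) : Rel (fg R E e * fv R E (E.s e)) (fg R E e)
  | ck1_self (e : E.Edge) : Rel (fg R E e * fe R E e) (fv R E (E.r e))
  | ck1_ne (e f : E.Edge) (h : e ≠ f) : Rel (fg R E e * fe R E f) 0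
  | ck2 (a : E.Vertex) (h : E.IsRegular a) :
      Rel (fv R E a) (∑ e ∈ h.1.toFinset, fe R E e * fg R E e)

/-- The smallest ring congruence on the free algebra that contains all scalar multiples of the
defining relations, i.e. the smallest `R`-algebra congruence that contains the relations (the
algebra has no unit, so multiplication by scalars has to be put in). -/
noncomputable def con : RingCon (Free R E) :=
  ringConGen fun a b => ∃ (c : R) (p q : Free R E), Rel R E p q ∧ a = c • p ∧ b = c • q

theorem con_smul (c : R) {a b : Free R E} (h : con R E a b) : con R E (c • a) (c • b) := by
  have h' : RingConGen.Rel _ a b := h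
  change RingConGen.Rel _ (c • a) (c • b)
  clear h
  induction h' with
  | of a b h =>
    obtain ⟨d, p, q, hpq, rfl, rfl⟩ := h
    exact RingConGen.Rel.of _ _ ⟨c * d, p, q, hpq, smul_smul c d p, smul_smul c d q⟩
  | refl a => exact RingConGen.Rel.refl _
  | symm _ ih => exact ih.symm
  | trans _ _ ih₁ ih₂ => exact ih₁.trans ih₂
  | add _ _ ih₁ ih₂ => rw [smul_add, smul_add]; exact ih₁.add ih₂
  | mul _ h₂ ih₁ _ => rw [← smul_mul_assoc, ← smul_mul_assoc]; exact ih₁.mul h₂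

end LeavittPathAlgebra

/-- The Leavitt path algebra `L_R(E)`: the universal (associative, not necessarily unital)
`R`-algebra on vertices, edges and ghost edges of `E` subject to the defining relations. -/
def LeavittPathAlgebra (R : Type w) [CommRing R] (E : DirectedGraph.{u, v}) :
    Type (max u v w) :=
  (LeavittPathAlgebra.con R E).Quotient

namespace LeavittPathAlgebra

variable (R : Type w) [CommRing R] (E : DirectedGraph.{u, v})

noncomputable instance : NonUnitalRing (LeavittPathAlgebra R E) :=
  inferInstanceAs (NonUnitalRing (con R E).Quotient)

/-- The quotient map from the free algebra. -/
noncomputable def mk (a : Free R E) : LeavittPathAlgebra R E := RingCon.toQuotient (c := con R E) a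

variable {R E}

theorem mk_surjective : Function.Surjective (mk R E) := Quotient.mk''_surjective

theorem mk_add (a b : Free R E) : mk R E (a + b) = mk R E a + mk R E b := rfl

theorem mk_mul (a b : Free R E) : mk R E (a * b) = mk R E a * mk R E b := rfl

theorem mk_zero : mk R E 0 = 0 := rfl

noncomputable instance : SMul R (LeavittPathAlgebra R E) where
  smul c := Quotient.map' (c • ·) fun _ _ h => con_smul R E c h

theorem mk_smul (c : R) (a : Free R E) : mk R E (c • a) = c • mk R E a := rfl

noncomputable instance : Module R (LeavittPathAlgebra R E) where
  one_smul b := by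
    obtain ⟨a, rfl⟩ := mk_surjective b
    rw [← mk_smul, one_smul]
  mul_smul c d b := by
    obtain ⟨a, rfl⟩ := mk_surjective b
    rw [← mk_smul, ← mk_smul, ← mk_smul, mul_smul]
  smul_zero c := by rw [← mk_zero, ← mk_smul, smul_zero]
  smul_add c b b' := by
    obtain ⟨a, rfl⟩ := mk_surjective b
    obtain ⟨a', rfl⟩ := mk_surjective b'
    rw [← mk_add, ← mk_smul, ← mk_smul, ← mk_smul, ← mk_add, smul_add]
  add_smul c d b := by
    obtain ⟨a, rfl⟩ := mk_surjective b
    rw [← mk_smul, ← mk_smul, ← mk_smul, ← mk_add, add_smul]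
  zero_smul b := by
    obtain ⟨a, rfl⟩ := mk_surjective b
    rw [← mk_smul, zero_smul, mk_zero]

instance : IsScalarTower R (LeavittPathAlgebra R E) (LeavittPathAlgebra R E) where
  smul_assoc c b b' := by
    obtain ⟨a, rfl⟩ := mk_surjective b
    obtain ⟨a', rfl⟩ := mk_surjective b'
    rw [smul_eq_mul, smul_eq_mul, ← mk_smul, ← mk_mul, ← mk_mul, ← mk_smul, smul_mul_assoc]

instance : SMulCommClass R (LeavittPathAlgebra R E) (LeavittPathAlgebra R E) where
  smul_comm c b b' := by
    obtain ⟨a, rfl⟩ := mk_surjective b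
    obtain ⟨a', rfl⟩ := mk_surjective b'
    rw [smul_eq_mul, smul_eq_mul, ← mk_smul, ← mk_mul, ← mk_mul, ← mk_smul, mul_smul_comm]

end LeavittPathAlgebra

/-- Isomorphism of (not necessarily unital) `R`-algebras: there is a bijective map that respects
addition, multiplication and scalars. Such a map carries an identity element, if there is one,
to an identity element. -/
def AlgIsomorphic (R : Type w) [CommRing R] (A : Type u) (B : Type v)
    [NonUnitalRing A] [Module R A] [NonUnitalRing B] [Module R B] : Prop :=
  ∃ φ : A →ₙₐ[R] B, Function.Bijective φ

/-- `A` is (isomorphic to) an algebraic Cuntz–Krieger algebra over `R`, i.e. to `L_R(G)` for a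
finite graph `G` with no sinks and no sources. -/
def IsAlgebraicCuntzKrieger (R : Type w) [CommRing R] (A : Type u)
    [NonUnitalRing A] [Module R A] : Prop :=
  ∃ G : DirectedGraph.{0, 0}, G.IsFinite ∧ G.NoSinks ∧ G.NoSources ∧
    AlgIsomorphic R A (LeavittPathAlgebra R G)

/-! Three moves on a finite graph without sinks preserve the Leavitt path algebra, and together they
remove all sources.

Unrolling at a vertex `v` without loops replaces each edge `e` into `v` by the paths `eg` with `g`
emitted by `v`. Nothing is lost, since `v = ∑ gg*` gives `e = ∑ (eg)g*`. The vertex `v` becomes a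
source, so repeated unrolling leaves a loop at every vertex that is not a source
(`algIsomorphic_unroll`, `exists_loops`).

Splitting replaces a source by one vertex for each edge `e` it emits, namely the projection `ee*`.
As a source is the range of no edge, no relation `e*e = r(e)` involves it. Afterwards every source
emits exactly one edge (`algIsomorphic_splitSources`).

Redirecting uses that, if `e₀` is the only edge emitted by `s(e₀)`, then `e₀e₀* = s(e₀)` and `e₀*e₀
= r(e₀)`. These two projections are equivalent, so an edge `f ≠ e₀` into `r(e₀)` can be traded for
`fe₀*`, which ends at `s(e₀)`. If `f` starts at a non-source, for instance if it is a loop at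
`r(e₀)`, the source `s(e₀)` disappears and no new one arises, because `r(e₀)` still receives `e₀`
(`algIsomorphic_redirect`, `exists_noSources_of_redirect`).

Each isomorphism comes from a pair of mutually inverse families (`algIsomorphic_of_families`). -/

/-! ### Finite graphs: emitted edges, sinks and sources -/

namespace DirectedGraph

variable {E : DirectedGraph.{u, v}}

/-- The finite set of edges emitted by a vertex of a finite graph. -/
noncomputable def IsFinite.out (h : E.IsFinite) (a : E.Vertex) : Finset E.Edge :=
  have := h.2
  (Set.toFinite (E.s ⁻¹' {a})).toFinset

theorem IsFinite.mem_out (h : E.IsFinite) (a : E.Vertex) (e : E.Edge) :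
    e ∈ h.out a ↔ E.s e = a := by
  simp [IsFinite.out]

theorem IsFinite.isRegular (h : E.IsFinite) (hs : E.NoSinks) (a : E.Vertex) : E.IsRegular a := by
  have := h.2
  exact ⟨Set.toFinite _, Set.nonempty_iff_ne_empty.2 (hs a)⟩

theorem noSinks_iff : E.NoSinks ↔ ∀ a, ∃ e, E.s e = a := by
  simp [NoSinks, IsSink, Set.eq_empty_iff_forall_notMem]

theorem not_isSource_iff {a : E.Vertex} : ¬ E.IsSource a ↔ ∃ e, E.r e = a := by
  simp [IsSource, Set.eq_empty_iff_forall_notMem]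

theorem isSource_iff {a : E.Vertex} : E.IsSource a ↔ ∀ e, E.r e ≠ a := by
  simp [IsSource, Set.eq_empty_iff_forall_notMem]

end DirectedGraph

/-! ### Generators, the universal property, and isomorphisms from families -/

namespace LeavittPathAlgebra

section generators

variable (R : Type w) [CommRing R] (E : DirectedGraph.{u, v})

/-- The vertex `a` in the Leavitt path algebra. -/
noncomputable def vert (a : E.Vertex) : LeavittPathAlgebra R E := mk R E (fv R E a)

/-- The edge `e` in the Leavitt path algebra. -/
noncomputable def edge (e : E.Edge) : LeavittPathAlgebra R E := mk R E (fe R E e)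

/-- The ghost edge `e*` in the Leavitt path algebra. -/
noncomputable def ghost (e : E.Edge) : LeavittPathAlgebra R E := mk R E (fg R E e)

variable {R E}

theorem mk_eq_of_rel {p q : Free R E} (h : Rel R E p q) : mk R E p = mk R E q :=
  (RingCon.eq _).2 (RingConGen.Rel.of _ _ ⟨1, p, q, h, by simp, by simp⟩)

theorem vert_mul_edge (e : E.Edge) : vert R E (E.s e) * edge R E e = edge R E e :=
  mk_eq_of_rel (.source_edge e)

theorem edge_mul_vert (e : E.Edge) : edge R E e * vert R E (E.r e) = edge R E e :=
  mk_eq_of_rel (.edge_range e)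

theorem vert_mul_ghost (e : E.Edge) : vert R E (E.r e) * ghost R E e = ghost R E e :=
  mk_eq_of_rel (.range_ghost e)

theorem ghost_mul_vert (e : E.Edge) : ghost R E e * vert R E (E.s e) = ghost R E e :=
  mk_eq_of_rel (.ghost_source e)

theorem ghost_mul_edge_self (e : E.Edge) : ghost R E e * edge R E e = vert R E (E.r e) :=
  mk_eq_of_rel (.ck1_self e)

theorem ghost_mul_edge_ne {e f : E.Edge} (h : e ≠ f) : ghost R E e * edge R E f = 0 :=
  mk_eq_of_rel (.ck1_ne e f h)

variable (R E) in
/-- The quotient map as a homomorphism of algebras. -/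
noncomputable def mkHom : Free R E →ₙₐ[R] LeavittPathAlgebra R E where
  toFun := mk R E
  map_smul' := mk_smul
  map_zero' := mk_zero
  map_add' := mk_add
  map_mul' := mk_mul

/-- The index set is any finset with the right members, so each application can choose a convenient
description of the edges emitted by `a`. -/
theorem vert_eq_sum (hE : E.IsFinite) (hs : E.NoSinks) (a : E.Vertex) (s : Finset E.Edge)
    (h : ∀ e, e ∈ s ↔ E.s e = a) : vert R E a = ∑ e ∈ s, edge R E e * ghost R E e := by
  have h₁ := mk_eq_of_rel (R := R) (.ck2 a (hE.isRegular hs a))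
  have h₂ : (hE.isRegular hs a).1.toFinset = s := by
    ext e
    simp [h]
  rw [h₂] at h₁
  refine h₁.trans ((map_sum (mkHom R E) _ _).trans ?_)
  exact Finset.sum_congr rfl fun e _ => mk_mul _ _

/-- Two homomorphisms that agree on the generators are equal. -/
theorem hom_ext {A : Type*} [NonUnitalRing A] [Module R A] {φ ψ : LeavittPathAlgebra R E →ₙₐ[R] A}
    (hv : ∀ a, φ (vert R E a) = ψ (vert R E a)) (he : ∀ e, φ (edge R E e) = ψ (edge R E e))
    (hg : ∀ e, φ (ghost R E e) = ψ (ghost R E e)) : φ = ψ := by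
  have h : φ.comp (mkHom R E) = ψ.comp (mkHom R E) := by
    refine MonoidAlgebra.nonUnitalAlgHom_ext' R (FreeSemigroup.hom_ext (funext fun g => ?_))
    cases g with
    | vertex a => exact hv a
    | edge e => exact he e
    | ghost e => exact hg e
  ext x
  obtain ⟨y, rfl⟩ := mk_surjective x
  exact DFunLike.congr_fun h y

end generators

/-- A family of elements that satisfies the relations of the Leavitt path algebra of a graph in
which every vertex emits a finite, non-zero number of edges; the remaining relations follow. -/
structure Family (E : DirectedGraph.{u, v}) (A : Type*) [NonUnitalRing A] where
  /-- the images of the vertices -/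
  p : E.Vertex → A
  /-- the images of the edges -/
  a : E.Edge → A
  /-- the images of the ghost edges -/
  b : E.Edge → A
  b_mul_a_self : ∀ e, b e * a e = p (E.r e)
  b_mul_a_ne : ∀ e f, e ≠ f → b e * a f = 0
  a_mul_p : ∀ e, a e * p (E.r e) = a e
  p_mul_b : ∀ e, p (E.r e) * b e = b e
  p_eq_sum : ∀ v (s : Finset E.Edge), (∀ e, e ∈ s ↔ E.s e = v) → p v = ∑ e ∈ s, a e * b e

namespace Family

variable {R : Type w} [CommRing R] {E : DirectedGraph.{u, v}} {A : Type*} [NonUnitalRing A]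
  [Module R A] [IsScalarTower R A A] [SMulCommClass R A A]

/-- Expand `p (s e)` as `∑ f f*`: in `∑ f f* e` only the term `f = e` survives, and `e e* e = e r(e)
= e`. -/
theorem p_mul_a (S : Family E A) (hE : E.IsFinite) (e : E.Edge) :
    S.p (E.s e) * S.a e = S.a e := by
  classical
  rw [S.p_eq_sum _ (hE.out (E.s e)) (hE.mem_out _), Finset.sum_mul,
    Finset.sum_eq_single e, mul_assoc, S.b_mul_a_self, S.a_mul_p]
  · intro f _ hf
    rw [mul_assoc, S.b_mul_a_ne _ _ hf, mul_zero]
  · intro h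
    exact absurd ((hE.mem_out _ _).2 rfl) h

theorem b_mul_p (S : Family E A) (hE : E.IsFinite) (e : E.Edge) :
    S.b e * S.p (E.s e) = S.b e := by
  classical
  rw [S.p_eq_sum _ (hE.out (E.s e)) (hE.mem_out _), Finset.mul_sum,
    Finset.sum_eq_single e, ← mul_assoc, S.b_mul_a_self, S.p_mul_b]
  · intro f _ hf
    rw [← mul_assoc, S.b_mul_a_ne _ _ hf.symm, zero_mul]
  · intro h
    exact absurd ((hE.mem_out _ _).2 rfl) h

theorem p_mul_self (S : Family E A) (hE : E.IsFinite) (v : E.Vertex) :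
    S.p v * S.p v = S.p v := by
  -- Both factors are expanded, the product is distributed over the right one, and the left one is
  -- folded back into `p v`.
  conv_lhs => rw [S.p_eq_sum v (hE.out v) (hE.mem_out v), Finset.mul_sum,
    ← S.p_eq_sum v (hE.out v) (hE.mem_out v)]
  conv_rhs => rw [S.p_eq_sum v (hE.out v) (hE.mem_out v)]
  refine Finset.sum_congr rfl fun e he => ?_
  obtain rfl := (hE.mem_out _ _).1 he
  rw [← mul_assoc, S.p_mul_a hE]

theorem p_mul_ne (S : Family E A) (hE : E.IsFinite) {v w : E.Vertex} (h : v ≠ w) :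
    S.p v * S.p w = 0 := by
  rw [S.p_eq_sum v (hE.out v) (hE.mem_out v), S.p_eq_sum w (hE.out w) (hE.mem_out w),
    Finset.sum_mul_sum]
  refine Finset.sum_eq_zero fun e he => Finset.sum_eq_zero fun f hf => ?_
  rw [hE.mem_out] at he hf
  have hef : e ≠ f := by
    rintro rfl
    exact h (he.symm.trans hf)
  rw [mul_assoc, ← mul_assoc (S.b e), S.b_mul_a_ne _ _ hef, zero_mul, mul_zero]

/-- The value of a family on a generator. -/
def onGen (S : Family E A) : Gen E → A
  | .vertex a => S.p a
  | .edge e => S.a e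
  | .ghost e => S.b e

variable (R) in
/-- The homomorphism from the free algebra given by a family. -/
noncomputable def freeLift (S : Family E A) : Free R E →ₙₐ[R] A :=
  MonoidAlgebra.liftMagma R (FreeSemigroup.lift S.onGen)

theorem freeLift_gen (S : Family E A) (g : Gen E) : S.freeLift R (gen R E g) = S.onGen g := by
  simp [freeLift, gen]

theorem freeLift_rel (S : Family E A) (hE : E.IsFinite) {x y : Free R E} (h : Rel R E x y) :
    S.freeLift R x = S.freeLift R y := by
  cases h with
  | idem a => simpa [freeLift_gen, onGen] using S.p_mul_self hE a
  | orth a b h => simpa [freeLift_gen, onGen] using S.p_mul_ne hE h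
  | source_edge e => simpa [freeLift_gen, onGen] using S.p_mul_a hE e
  | edge_range e => simpa [freeLift_gen, onGen] using S.a_mul_p e
  | range_ghost e => simpa [freeLift_gen, onGen] using S.p_mul_b e
  | ghost_source e => simpa [freeLift_gen, onGen] using S.b_mul_p hE e
  | ck1_self e => simpa [freeLift_gen, onGen] using S.b_mul_a_self e
  | ck1_ne e f h => simpa [freeLift_gen, onGen] using S.b_mul_a_ne e f h
  | ck2 a h => simpa [freeLift_gen, onGen] using S.p_eq_sum a h.1.toFinset (by simp)

theorem freeLift_con (S : Family E A) (hE : E.IsFinite) {x y : Free R E} (h : con R E x y) :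
    S.freeLift R x = S.freeLift R y := by
  have h' : RingConGen.Rel _ x y := h
  clear h
  induction h' with
  | of a b h =>
    obtain ⟨c, p, q, hpq, rfl, rfl⟩ := h
    rw [map_smul, map_smul, S.freeLift_rel hE hpq]
  | refl a => rfl
  | symm _ ih => exact ih.symm
  | trans _ _ ih₁ ih₂ => exact ih₁.trans ih₂
  | add _ _ ih₁ ih₂ => rw [map_add, map_add, ih₁, ih₂]
  | mul _ _ ih₁ ih₂ => rw [map_mul, map_mul, ih₁, ih₂]

variable (R) in
/-- The homomorphism from the Leavitt path algebra given by a family. -/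
noncomputable def lift (S : Family E A) (hE : E.IsFinite) : LeavittPathAlgebra R E →ₙₐ[R] A where
  toFun := Quotient.lift (S.freeLift R) fun _ _ h => S.freeLift_con hE h
  map_smul' c x := by
    obtain ⟨x, rfl⟩ := mk_surjective x
    exact map_smul (S.freeLift R) c x
  map_zero' := map_zero (S.freeLift R)
  map_add' x y := by
    obtain ⟨x, rfl⟩ := mk_surjective x
    obtain ⟨y, rfl⟩ := mk_surjective y
    exact map_add (S.freeLift R) x y
  map_mul' x y := by
    obtain ⟨x, rfl⟩ := mk_surjective x
    obtain ⟨y, rfl⟩ := mk_surjective y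
    exact map_mul (S.freeLift R) x y

variable (S : Family E A) (hE : E.IsFinite)

@[simp] theorem lift_vert (a : E.Vertex) : S.lift R hE (vert R E a) = S.p a := S.freeLift_gen _

@[simp] theorem lift_edge (e : E.Edge) : S.lift R hE (edge R E e) = S.a e := S.freeLift_gen _

@[simp] theorem lift_ghost (e : E.Edge) : S.lift R hE (ghost R E e) = S.b e := S.freeLift_gen _

end Family

theorem AlgIsomorphic_trans {R : Type w} [CommRing R] {A B C : Type*} [NonUnitalRing A] [Module R A]
    [NonUnitalRing B] [Module R B] [NonUnitalRing C] [Module R C]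
    (h₁ : AlgIsomorphic R A B) (h₂ : AlgIsomorphic R B C) : AlgIsomorphic R A C := by
  obtain ⟨φ, hφ⟩ := h₁
  obtain ⟨ψ, hψ⟩ := h₂
  exact ⟨ψ.comp φ, hψ.comp hφ⟩

section iso

universe u' v'

variable {R : Type w} [CommRing R] {E : DirectedGraph.{u, v}} {G : DirectedGraph.{u', v'}}

/-- Without sinks each vertex is a sum of elements `ee*`, so the values on edges and ghost edges
determine a homomorphism. -/
theorem hom_ext_of_noSinks (hE : E.IsFinite) (hs : E.NoSinks) {A : Type*} [NonUnitalRing A]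
    [Module R A] {φ ψ : LeavittPathAlgebra R E →ₙₐ[R] A}
    (he : ∀ e, φ (edge R E e) = ψ (edge R E e))
    (hg : ∀ e, φ (ghost R E e) = ψ (ghost R E e)) : φ = ψ := by
  refine hom_ext (fun a => ?_) he hg
  rw [vert_eq_sum hE hs a (hE.out a) (hE.mem_out a)]
  simp only [map_sum, map_mul, he, hg]

/-- Mutually inverse families give an isomorphism of Leavitt path algebras. -/
theorem algIsomorphic_of_families (hE : E.IsFinite) (hEs : E.NoSinks) (hG : G.IsFinite)
    (hGs : G.NoSinks) (S : Family E (LeavittPathAlgebra R G))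
    (T : Family G (LeavittPathAlgebra R E))
    (h₁ : ∀ e, T.lift R hG (S.a e) = edge R E e) (h₂ : ∀ e, T.lift R hG (S.b e) = ghost R E e)
    (h₃ : ∀ e, S.lift R hE (T.a e) = edge R G e) (h₄ : ∀ e, S.lift R hE (T.b e) = ghost R G e) :
    AlgIsomorphic R (LeavittPathAlgebra R E) (LeavittPathAlgebra R G) := by
  have h : (T.lift R hG).comp (S.lift R hE) = NonUnitalAlgHom.id R _ :=
    hom_ext_of_noSinks hE hEs (fun e => by simp [h₁]) (fun e => by simp [h₂])
  have h' : (S.lift R hE).comp (T.lift R hG) = NonUnitalAlgHom.id R _ :=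
    hom_ext_of_noSinks hG hGs (fun e => by simp [h₃]) (fun e => by simp [h₄])
  exact ⟨S.lift R hE, Function.bijective_iff_has_inverse.2
    ⟨T.lift R hG, DFunLike.congr_fun h, DFunLike.congr_fun h'⟩⟩

end iso

end LeavittPathAlgebra

namespace LeavittPathAlgebra

variable {R : Type w} [CommRing R]

/-! ### Invariance under isomorphism of graphs -/

section relabel

universe u' v'

variable {E : DirectedGraph.{u, v}} {G : DirectedGraph.{u', v'}}

/-- The canonical family given by an isomorphism of graphs. -/
noncomputable def relabelFamily (hG : G.IsFinite) (hGs : G.NoSinks) (α : E.Vertex ≃ G.Vertex)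
    (β : E.Edge ≃ G.Edge) (hs : ∀ e, G.s (β e) = α (E.s e)) (hr : ∀ e, G.r (β e) = α (E.r e)) :
    Family E (LeavittPathAlgebra R G) where
  p v := vert R G (α v)
  a e := edge R G (β e)
  b e := ghost R G (β e)
  b_mul_a_self e := by rw [ghost_mul_edge_self, hr]
  b_mul_a_ne e f h := ghost_mul_edge_ne (β.injective.ne h)
  a_mul_p e := by rw [← hr, edge_mul_vert]
  p_mul_b e := by rw [← hr, vert_mul_ghost]
  p_eq_sum v s h := by
    rw [vert_eq_sum hG hGs (α v) (s.map β.toEmbedding), Finset.sum_map]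
    · rfl
    · intro e
      obtain ⟨e, rfl⟩ := β.surjective e
      simp [h, hs]

/-- Isomorphic graphs have isomorphic Leavitt path algebras. -/
theorem algIsomorphic_of_relabel (hE : E.IsFinite) (hEs : E.NoSinks) (hG : G.IsFinite)
    (hGs : G.NoSinks) (α : E.Vertex ≃ G.Vertex)
    (β : E.Edge ≃ G.Edge) (hs : ∀ e, G.s (β e) = α (E.s e)) (hr : ∀ e, G.r (β e) = α (E.r e)) :
    AlgIsomorphic R (LeavittPathAlgebra R E) (LeavittPathAlgebra R G) :=
  algIsomorphic_of_families hE hEs hG hGs (relabelFamily hG hGs α β hs hr)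
    (relabelFamily hE hEs α.symm β.symm (fun e => by rw [← α.symm_apply_apply (E.s _), ← hs]; simp)
      (fun e => by rw [← α.symm_apply_apply (E.r _), ← hr]; simp))
    (by simp [relabelFamily]) (by simp [relabelFamily]) (by simp [relabelFamily])
    (by simp [relabelFamily])

end relabel

/-! ### Redirecting an edge to a vertex that emits a single edge -/

section redirect

variable {E : DirectedGraph.{u, v}}

open Classical in
/-- The graph in which the edge `f` is redirected to the vertex `v`. -/
noncomputable abbrev _root_.DirectedGraph.redirect (E : DirectedGraph.{u, v}) (f : E.Edge)
    (v : E.Vertex) : DirectedGraph.{u, v} where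
  Vertex := E.Vertex
  Edge := E.Edge
  s := E.s
  r := Function.update E.r f v

theorem redirect_r_self (f : E.Edge) (v : E.Vertex) : (E.redirect f v).r f = v :=
  by simp [DirectedGraph.redirect]

theorem redirect_r_ne {f e : E.Edge} (h : e ≠ f) (v : E.Vertex) : (E.redirect f v).r e = E.r e :=
  by simp [DirectedGraph.redirect, h]

variable {f e₀ : E.Edge}

theorem edge_mul_ghost_of_unique {G : DirectedGraph.{u, v}} (hG : G.IsFinite) (hGs : G.NoSinks)
    {e₀ : G.Edge} (hu : ∀ e, G.s e = G.s e₀ → e = e₀) :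
    edge R G e₀ * ghost R G e₀ = vert R G (G.s e₀) := by
  rw [vert_eq_sum hG hGs (G.s e₀) {e₀}, Finset.sum_singleton]
  intro e
  rw [Finset.mem_singleton]
  exact ⟨fun h => h ▸ rfl, hu e⟩

open Classical in
/-- The family in the algebra of the redirected graph `G`. -/
noncomputable def toRedirect (hG : (E.redirect f (E.s e₀)).IsFinite)
    (hGs : (E.redirect f (E.s e₀)).NoSinks) (hu : ∀ e, E.s e = E.s e₀ → e = e₀)
    (hf : f ≠ e₀) (hr : E.r f = E.r e₀) :
    Family E (LeavittPathAlgebra R (E.redirect f (E.s e₀))) :=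
  let G := E.redirect f (E.s e₀)
  have hf₂ : vert R G (E.s e₀) * ghost R G f = ghost R G f := by
    have := vert_mul_ghost (R := R) (E := G) f
    rwa [redirect_r_self] at this
  have h₁ : edge R G e₀ * vert R G (E.r e₀) = edge R G e₀ := by
    have := edge_mul_vert (R := R) (E := G) e₀
    rwa [redirect_r_ne hf.symm] at this
  have h₂ : vert R G (E.r e₀) * ghost R G e₀ = ghost R G e₀ := by
    have := vert_mul_ghost (R := R) (E := G) e₀
    rwa [redirect_r_ne hf.symm] at this
  have h₃ : edge R G e₀ * ghost R G e₀ = vert R G (E.s e₀) :=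
    edge_mul_ghost_of_unique (G := G) hG hGs hu
  have h₄ : vert R G (E.s e₀) * edge R G e₀ = edge R G e₀ := vert_mul_edge (R := R) (E := G) e₀
  { p := fun v => vert R G v
    -- In the new graph `f` ends at `s(e₀)`, so the old edge is the path `f e₀`.
    a := fun e => if e = f then edge R G f * edge R G e₀ else edge R G e
    b := fun e => if e = f then ghost R G e₀ * ghost R G f else ghost R G e
    b_mul_a_self := fun e => by
      split_ifs with h
      · subst h
        rw [mul_assoc, ← mul_assoc (ghost R G e), ghost_mul_edge_self, redirect_r_self, h₄,
          ghost_mul_edge_self, redirect_r_ne hf.symm, hr]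
      · rw [ghost_mul_edge_self, redirect_r_ne h]
    b_mul_a_ne := fun e e' h => by
      split_ifs with h₁ h₂ h₂
      · exact absurd (h₁.trans h₂.symm) h
      · rw [mul_assoc, ghost_mul_edge_ne (E := G) (Ne.symm h₂), mul_zero]
      · rw [← mul_assoc, ghost_mul_edge_ne (E := G) h₁, zero_mul]
      · exact ghost_mul_edge_ne (E := G) h
    a_mul_p := fun e => by
      split_ifs with h
      · rw [h, hr, mul_assoc, h₁]
      · have := edge_mul_vert (R := R) (E := G) e
        rwa [redirect_r_ne h] at this
    p_mul_b := fun e => by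
      split_ifs with h
      · rw [h, hr, ← mul_assoc, h₂]
      · have := vert_mul_ghost (R := R) (E := G) e
        rwa [redirect_r_ne h] at this
    p_eq_sum := fun v s hs => by
      rw [vert_eq_sum (E := G) hG hGs v s hs]
      refine Finset.sum_congr rfl fun e _ => ?_
      split_ifs with h
      -- The detour is invisible in the sum: `(f e₀)(f e₀)* = f (e₀e₀*) f* = f s(e₀) f* = f f*`.
      · rw [h, mul_assoc, ← mul_assoc (edge R G e₀), h₃, hf₂]
      · rfl }

open Classical in
/-- The family of the redirected graph in the algebra of the original graph. -/
noncomputable def ofRedirect (hE : E.IsFinite) (hEs : E.NoSinks)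
    (hu : ∀ e, E.s e = E.s e₀ → e = e₀) (hr : E.r f = E.r e₀) :
    Family (E.redirect f (E.s e₀)) (LeavittPathAlgebra R E) :=
  have h₃ : edge R E e₀ * ghost R E e₀ = vert R E (E.s e₀) := edge_mul_ghost_of_unique hE hEs hu
  have h₀ : ghost R E f * edge R E f = ghost R E e₀ * edge R E e₀ := by
    rw [ghost_mul_edge_self, ghost_mul_edge_self, hr]
  { p := fun v : E.Vertex => vert R E v
    -- The inverse substitution: going back along `e₀*` moves the range of `f` from `r(e₀)` to
    -- `s(e₀)`.
    a := fun e : E.Edge => if e = f then edge R E f * ghost R E e₀ else edge R E e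
    b := fun e : E.Edge => if e = f then edge R E e₀ * ghost R E f else ghost R E e
    b_mul_a_self := fun (e : E.Edge) => by
      split_ifs with h
      · subst h
        rw [mul_assoc, ← mul_assoc (ghost R E e), h₀, ghost_mul_edge_self, vert_mul_ghost,
          redirect_r_self, h₃]
      · rw [ghost_mul_edge_self, redirect_r_ne h]
    b_mul_a_ne := fun (e e' : E.Edge) h => by
      split_ifs with h₁ h₂ h₂
      · exact absurd (h₁.trans h₂.symm) h
      · rw [mul_assoc, ghost_mul_edge_ne (Ne.symm h₂), mul_zero]
      · rw [← mul_assoc, ghost_mul_edge_ne h₁, zero_mul]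
      · exact ghost_mul_edge_ne h
    a_mul_p := fun (e : E.Edge) => by
      split_ifs with h
      · rw [h, redirect_r_self, mul_assoc, ghost_mul_vert]
      · rw [redirect_r_ne h, edge_mul_vert]
    p_mul_b := fun (e : E.Edge) => by
      split_ifs with h
      · rw [h, redirect_r_self, ← mul_assoc, vert_mul_edge]
      · rw [redirect_r_ne h, vert_mul_ghost]
    p_eq_sum := fun v s hs => by
      rw [vert_eq_sum hE hEs v s hs]
      refine Finset.sum_congr rfl fun e _ => ?_
      split_ifs with h
      · rw [h, mul_assoc, ← mul_assoc (ghost R E e₀), ghost_mul_edge_self, ← hr, vert_mul_ghost]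
      · rfl }

/-- If the vertex `s(e₀)` emits no edge besides `e₀`, then another edge with the same range as
`e₀` may be redirected to `s(e₀)`. -/
theorem algIsomorphic_redirect (hE : E.IsFinite) (hEs : E.NoSinks)
    (hu : ∀ e, E.s e = E.s e₀ → e = e₀) (hf : f ≠ e₀) (hr : E.r f = E.r e₀) :
    AlgIsomorphic R (LeavittPathAlgebra R E)
      (LeavittPathAlgebra R (E.redirect f (E.s e₀))) := by
  have hG : (E.redirect f (E.s e₀)).IsFinite := hE
  have hGs : (E.redirect f (E.s e₀)).NoSinks := hEs
  have h₁ : edge R E f * (ghost R E e₀ * edge R E e₀) = edge R E f := by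
    rw [ghost_mul_edge_self, ← hr, edge_mul_vert]
  have h₂ : (ghost R E e₀ * edge R E e₀) * ghost R E f = ghost R E f := by
    rw [ghost_mul_edge_self, ← hr, vert_mul_ghost]
  have h₃ : edge R (E.redirect f (E.s e₀)) e₀ * ghost R (E.redirect f (E.s e₀)) e₀ =
      vert R (E.redirect f (E.s e₀)) (E.s e₀) :=
    edge_mul_ghost_of_unique (G := E.redirect f (E.s e₀)) hG hGs hu
  have h₄ := edge_mul_vert (R := R) (E := E.redirect f (E.s e₀)) f
  have h₅ := vert_mul_ghost (R := R) (E := E.redirect f (E.s e₀)) f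
  rw [redirect_r_self] at h₄ h₅
  refine algIsomorphic_of_families hE hEs hG hGs (toRedirect hG hGs hu hf hr)
    (ofRedirect hE hEs hu hr) (fun e => ?_) (fun e => ?_) (fun e => ?_) (fun e => ?_)
  · by_cases h : e = f
    · simp only [toRedirect, h, if_true, map_mul, Family.lift_edge]
      simp only [ofRedirect, if_true, hf.symm, if_false, mul_assoc, h₁]
    · simp [toRedirect, h, ofRedirect]
  · by_cases h : e = f
    · simp only [toRedirect, h, if_true, map_mul, Family.lift_ghost]
      simp only [ofRedirect, if_true, hf.symm, if_false, ← mul_assoc, h₂]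
    · simp [toRedirect, h, ofRedirect]
  · change E.Edge at e
    by_cases h : e = f
    · simp only [ofRedirect, h, if_true, map_mul, Family.lift_edge, Family.lift_ghost]
      simp only [toRedirect, if_true, hf.symm, if_false, mul_assoc, h₃, h₄]
    · simp [toRedirect, h, ofRedirect]
  · change E.Edge at e
    by_cases h : e = f
    · simp only [ofRedirect, h, if_true, map_mul, Family.lift_edge, Family.lift_ghost]
      simp only [toRedirect, if_true, hf.symm, if_false, ← mul_assoc, h₃, h₅]
    · simp [toRedirect, h, ofRedirect]

end redirect

/-! ### Splitting sources into one vertex for each emitted edge -/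

section split

variable {E : DirectedGraph.{u, v}}

open Classical in
/-- The graph in which every source is split into one vertex for each edge it emits. -/
noncomputable abbrev _root_.DirectedGraph.splitSources (E : DirectedGraph.{u, v}) :
    DirectedGraph.{max u v, v} where
  Vertex := {a : E.Vertex // ¬ E.IsSource a} ⊕ {e : E.Edge // E.IsSource (E.s e)}
  Edge := E.Edge
  s e := if h : E.IsSource (E.s e) then .inr ⟨e, h⟩ else .inl ⟨E.s e, h⟩
  r e := .inl ⟨E.r e, DirectedGraph.not_isSource_iff.2 ⟨e, rfl⟩⟩

theorem splitSources_s_of_isSource {e : E.Edge} (h : E.IsSource (E.s e)) :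
    E.splitSources.s e = .inr ⟨e, h⟩ := dif_pos h

theorem splitSources_s_of_not {e : E.Edge} (h : ¬ E.IsSource (E.s e)) :
    E.splitSources.s e = .inl ⟨E.s e, h⟩ := dif_neg h

theorem splitSources_s_eq_inl {e : E.Edge} {a : {a : E.Vertex // ¬ E.IsSource a}} :
    E.splitSources.s e = .inl a ↔ E.s e = a := by
  by_cases h : E.IsSource (E.s e)
  · rw [splitSources_s_of_isSource h]
    simp only [reduceCtorEq, false_iff]
    exact fun h' => a.2 (h' ▸ h)
  · rw [splitSources_s_of_not h, Sum.inl.injEq, Subtype.ext_iff]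

theorem splitSources_s_eq_inr {e : E.Edge} {f : {e : E.Edge // E.IsSource (E.s e)}} :
    E.splitSources.s e = .inr f ↔ e = f := by
  by_cases h : E.IsSource (E.s e)
  · rw [splitSources_s_of_isSource h, Sum.inr.injEq, Subtype.ext_iff]
  · rw [splitSources_s_of_not h]
    simp only [reduceCtorEq, false_iff]
    rintro rfl
    exact h f.2

theorem splitSources_isFinite (hE : E.IsFinite) : E.splitSources.IsFinite := by
  have := hE.1
  have := hE.2
  exact ⟨inferInstanceAs (Finite ({a : E.Vertex // ¬ E.IsSource a} ⊕ _)), hE.2⟩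

theorem splitSources_noSinks (hs : E.NoSinks) : E.splitSources.NoSinks := by
  rw [DirectedGraph.noSinks_iff] at hs ⊢
  rintro (a | f)
  · obtain ⟨e, he⟩ := hs a
    exact ⟨e, splitSources_s_eq_inl.2 he⟩
  · exact ⟨f.1, splitSources_s_eq_inr.2 rfl⟩

/-- Splitting the sources does not change the Leavitt path algebra. -/
theorem algIsomorphic_splitSources (hE : E.IsFinite) (hEs : E.NoSinks) :
    AlgIsomorphic R (LeavittPathAlgebra R E) (LeavittPathAlgebra R E.splitSources) := by
  classical
  have hG := splitSources_isFinite hE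
  have hGs := splitSources_noSinks hEs
  have key (v : E.Vertex) (h : ¬ E.IsSource v) (s : Finset E.Edge) (hs : ∀ e, e ∈ s ↔ E.s e = v) :
      vert R E.splitSources (.inl ⟨v, h⟩) =
        ∑ e ∈ s, edge R E.splitSources e * ghost R E.splitSources e :=
    vert_eq_sum hG hGs (.inl ⟨v, h⟩) s
      fun e => (hs e).trans (splitSources_s_eq_inl (a := ⟨v, h⟩)).symm
  have hp (e : E.Edge) : ∑ e' ∈ hE.out (E.r e),
      edge R E.splitSources e' * ghost R E.splitSources e' =
        vert R E.splitSources (E.splitSources.r e) :=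
    (key _ (DirectedGraph.not_isSource_iff.2 ⟨e, rfl⟩) _ (hE.mem_out _)).symm
  let S : Family E (LeavittPathAlgebra R E.splitSources) :=
    -- At a source this is the sum of the vertices into which it splits; at any other vertex `key`
    -- identifies it with the retained vertex.
    { p := fun v => ∑ e ∈ hE.out v, edge R E.splitSources e * ghost R E.splitSources e
      a := fun e => edge R E.splitSources e
      b := fun e => ghost R E.splitSources e
      b_mul_a_self := fun e => by rw [hp, ghost_mul_edge_self]
      b_mul_a_ne := fun e f h => ghost_mul_edge_ne (E := E.splitSources) h
      a_mul_p := fun e => by rw [hp, edge_mul_vert]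
      p_mul_b := fun e => by rw [hp, vert_mul_ghost]
      p_eq_sum := fun v s hs => by
        have : s = hE.out v := by
          ext e
          rw [hs, hE.mem_out]
        rw [this] }
  let T : Family E.splitSources (LeavittPathAlgebra R E) :=
    -- A new vertex is the projection `ee*`. It is the range of no edge, so the relations that
    -- involve ranges are those of `E`.
    { p := Sum.elim (fun v => vert R E v) fun e => edge R E e * ghost R E e
      a := fun e : E.Edge => edge R E e
      b := fun e : E.Edge => ghost R E e
      b_mul_a_self := fun e => ghost_mul_edge_self (E := E) e
      b_mul_a_ne := fun e f h => ghost_mul_edge_ne (E := E) h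
      a_mul_p := fun e => edge_mul_vert (E := E) e
      p_mul_b := fun e => vert_mul_ghost (E := E) e
      p_eq_sum := fun v s hs => by
        obtain v | f := v
        · exact vert_eq_sum hE hEs v.1 s fun e => (hs e).trans splitSources_s_eq_inl
        · have : s = {f.1} := by
            ext e
            rw [hs, splitSources_s_eq_inr, Finset.mem_singleton]
          subst this
          simp }
  exact algIsomorphic_of_families hE hEs hG hGs S T (T.lift_edge hG) (T.lift_ghost hG)
    (S.lift_edge hE) (S.lift_ghost hE)

end split

end LeavittPathAlgebra

/-! ### Unrolling the edges into a vertex without loops -/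

namespace LeavittPathAlgebra

variable {R : Type w} [CommRing R] {E : DirectedGraph.{u, v}}

/-- The graph in which every edge `e` into `v` is replaced by the paths `eg` of length two, where
`g` runs over the edges emitted by `v`. -/
abbrev _root_.DirectedGraph.unroll (E : DirectedGraph.{u, v}) (v : E.Vertex) :
    DirectedGraph.{u, v} where
  Vertex := E.Vertex
  Edge := {e // E.r e ≠ v} ⊕ ({e // E.r e = v} × {g // E.s g = v})
  s := Sum.elim (fun e => E.s e) fun x => E.s x.1
  r := Sum.elim (fun e => E.r e) fun x => E.r x.2

theorem unroll_isFinite (hE : E.IsFinite) (v : E.Vertex) : (E.unroll v).IsFinite := by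
  have := hE.2
  exact ⟨hE.1, inferInstance⟩

theorem unroll_noSinks (hs : E.NoSinks) (v : E.Vertex) : (E.unroll v).NoSinks := by
  rw [DirectedGraph.noSinks_iff] at hs ⊢
  intro a
  obtain ⟨e, he⟩ := hs a
  by_cases h : E.r e = v
  · obtain ⟨g, hg⟩ := hs v
    exact ⟨.inr (⟨e, h⟩, ⟨g, hg⟩), he⟩
  · exact ⟨.inl ⟨e, h⟩, he⟩

theorem vert_eq_sum_ite [Fintype E.Edge] [DecidableEq E.Vertex] (hE : E.IsFinite)
    (hEs : E.NoSinks) (a : E.Vertex) :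
    vert R E a = ∑ e, if E.s e = a then edge R E e * ghost R E e else 0 := by
  rw [vert_eq_sum hE hEs a (Finset.univ.filter fun e => E.s e = a) (by simp), Finset.sum_filter]

theorem vert_eq_sum_subtype (hE : E.IsFinite) (hEs : E.NoSinks) (a : E.Vertex)
    [Fintype {g // E.s g = a}] :
    vert R E a = ∑ g : {g // E.s g = a}, edge R E g * ghost R E g := by
  classical
  rw [vert_eq_sum hE hEs a (Finset.univ.map (Function.Embedding.subtype fun g => E.s g = a))
    (by simp), Finset.sum_map]
  rfl

/-- The edges emitted by `a` are grouped by the original edge with which they begin, to match `∑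
ee*` in `E` term by term. -/
theorem vert_unroll [Fintype E.Edge] [DecidableEq E.Vertex] (hE : E.IsFinite) (hEs : E.NoSinks)
    (v a : E.Vertex) :
    vert R (E.unroll v) a =
      (∑ e : {e // E.r e ≠ v}, if E.s e = a then
        edge R (E.unroll v) (.inl e) * ghost R (E.unroll v) (.inl e) else 0) +
      ∑ e : {e // E.r e = v}, if E.s e = a then ∑ g : {g // E.s g = v},
        edge R (E.unroll v) (.inr (e, g)) * ghost R (E.unroll v) (.inr (e, g)) else 0 := by
  rw [vert_eq_sum_ite (E := E.unroll v) (unroll_isFinite hE v) (unroll_noSinks hEs v) a,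
    Fintype.sum_sum_type, Fintype.sum_prod_type]
  congr 1
  refine Finset.sum_congr rfl fun e _ => ?_
  split_ifs with h <;> simp [h]

/-- The vertex `v` of the unrolled graph. -/
theorem vert_unroll_self [Fintype E.Edge] [DecidableEq E.Vertex] (hE : E.IsFinite)
    (hEs : E.NoSinks) {v : E.Vertex} (hv : ∀ e, E.s e = v → E.r e ≠ v) :
    vert R (E.unroll v) v = ∑ g : {g // E.s g = v},
      edge R (E.unroll v) (.inl ⟨g, hv g g.2⟩) * ghost R (E.unroll v) (.inl ⟨g, hv g g.2⟩) := by
  classical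
  let ι : {g // E.s g = v} ↪ (E.unroll v).Edge :=
    ⟨fun g => .inl ⟨g, hv g g.2⟩, fun g g' h => by simpa [Subtype.ext_iff] using h⟩
  rw [vert_eq_sum (E := E.unroll v) (unroll_isFinite hE v) (unroll_noSinks hEs v) v
    (Finset.univ.map ι), Finset.sum_map]
  · rfl
  · rintro (e | ⟨e, g⟩)
    · simp only [Finset.mem_map, Finset.mem_univ, true_and]
      refine ⟨fun ⟨g, hg⟩ => ?_, fun h => ⟨⟨e, h⟩, rfl⟩⟩
      obtain rfl := Sum.inl_injective hg
      exact g.2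
    · simp only [Finset.mem_map, Finset.mem_univ, true_and]
      -- A path `eg` has `r(e) = v`, so if it started at `v` then `e` would be a loop there.
      exact ⟨fun ⟨g, hg⟩ => absurd hg Sum.inl_ne_inr, fun h => absurd e.2 (hv e h)⟩

section families

variable [Fintype E.Edge] [DecidableEq E.Vertex] {v : E.Vertex} (hv : ∀ e, E.s e = v → E.r e ≠ v)

/-- The image of an edge in the algebra of the unrolled graph. -/
noncomputable def unrollEdge (R : Type w) [CommRing R] (hv : ∀ e, E.s e = v → E.r e ≠ v)
    (e : E.Edge) : LeavittPathAlgebra R (E.unroll v) :=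
  if h : E.r e = v then
    ∑ g : {g // E.s g = v},
      edge R (E.unroll v) (.inr (⟨e, h⟩, g)) * ghost R (E.unroll v) (.inl ⟨g, hv g g.2⟩)
  else edge R (E.unroll v) (.inl ⟨e, h⟩)

/-- The image of a ghost edge in the algebra of the unrolled graph. -/
noncomputable def unrollGhost (R : Type w) [CommRing R] (hv : ∀ e, E.s e = v → E.r e ≠ v)
    (e : E.Edge) : LeavittPathAlgebra R (E.unroll v) :=
  if h : E.r e = v then
    ∑ g : {g // E.s g = v},
      edge R (E.unroll v) (.inl ⟨g, hv g g.2⟩) * ghost R (E.unroll v) (.inr (⟨e, h⟩, g))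
  else ghost R (E.unroll v) (.inl ⟨e, h⟩)

theorem unrollEdge_of_eq {e : E.Edge} (h : E.r e = v) :
    unrollEdge R hv e = ∑ g : {g // E.s g = v},
      edge R (E.unroll v) (.inr (⟨e, h⟩, g)) * ghost R (E.unroll v) (.inl ⟨g, hv g g.2⟩) :=
  dif_pos h

theorem unrollEdge_of_ne {e : E.Edge} (h : E.r e ≠ v) :
    unrollEdge R hv e = edge R (E.unroll v) (.inl ⟨e, h⟩) := dif_neg h

theorem unrollGhost_of_eq {e : E.Edge} (h : E.r e = v) :
    unrollGhost R hv e = ∑ g : {g // E.s g = v},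
      edge R (E.unroll v) (.inl ⟨g, hv g g.2⟩) * ghost R (E.unroll v) (.inr (⟨e, h⟩, g)) :=
  dif_pos h

theorem unrollGhost_of_ne {e : E.Edge} (h : E.r e ≠ v) :
    unrollGhost R hv e = ghost R (E.unroll v) (.inl ⟨e, h⟩) := dif_neg h

/-- For `r(e) = v` the cross terms of `∑ g (eg)* (eg') g'*` vanish and `∑ gg* = v` remains. The
absence of loops at `v` makes each `g` an edge of the unrolled graph. -/
theorem unrollGhost_mul_self (hE : E.IsFinite) (hEs : E.NoSinks) (e : E.Edge) :
    unrollGhost R hv e * unrollEdge R hv e = vert R (E.unroll v) (E.r e) := by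
  classical
  by_cases h : E.r e = v
  · rw [unrollGhost_of_eq hv h, unrollEdge_of_eq hv h, Finset.sum_mul_sum, h,
      vert_unroll_self hE hEs hv]
    refine Finset.sum_congr rfl fun g _ => ?_
    rw [Finset.sum_eq_single g]
    · rw [mul_assoc, ← mul_assoc (ghost _ _ _), ghost_mul_edge_self]
      exact congrArg _ (vert_mul_ghost (E := E.unroll v) (.inl ⟨g, hv g g.2⟩))
    · intro g' _ hg
      rw [mul_assoc, ← mul_assoc (ghost _ _ _), ghost_mul_edge_ne (by simpa using hg.symm),
        zero_mul, mul_zero]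
    · simp
  · rw [unrollGhost_of_ne hv h, unrollEdge_of_ne hv h, ghost_mul_edge_self]
    rfl

theorem unrollGhost_mul_ne {e f : E.Edge} (hef : e ≠ f) :
    unrollGhost R hv e * unrollEdge R hv f = 0 := by
  by_cases h : E.r e = v <;> by_cases h' : E.r f = v
  · rw [unrollGhost_of_eq hv h, unrollEdge_of_eq hv h', Finset.sum_mul_sum]
    refine Finset.sum_eq_zero fun g _ => Finset.sum_eq_zero fun g' _ => ?_
    rw [mul_assoc, ← mul_assoc (ghost _ _ _), ghost_mul_edge_ne (by simp [hef]),
      zero_mul, mul_zero]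
  · rw [unrollGhost_of_eq hv h, unrollEdge_of_ne hv h', Finset.sum_mul]
    refine Finset.sum_eq_zero fun g _ => ?_
    rw [mul_assoc, ghost_mul_edge_ne (by simp), mul_zero]
  · rw [unrollGhost_of_ne hv h, unrollEdge_of_eq hv h', Finset.mul_sum]
    refine Finset.sum_eq_zero fun g _ => ?_
    rw [← mul_assoc, ghost_mul_edge_ne (by simp), zero_mul]
  · rw [unrollGhost_of_ne hv h, unrollEdge_of_ne hv h']
    exact ghost_mul_edge_ne (by simpa using hef)

theorem unrollEdge_mul_vert (e : E.Edge) :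
    unrollEdge R hv e * vert R (E.unroll v) (E.r e) = unrollEdge R hv e := by
  by_cases h : E.r e = v
  · rw [unrollEdge_of_eq hv h, Finset.sum_mul, h]
    refine Finset.sum_congr rfl fun g _ => ?_
    have := ghost_mul_vert (R := R) (E := E.unroll v) (.inl ⟨g, hv g g.2⟩)
    simp only [Sum.elim_inl, g.2] at this
    rw [mul_assoc, this]
  · rw [unrollEdge_of_ne hv h]
    exact edge_mul_vert (E := E.unroll v) (.inl ⟨e, h⟩)

theorem vert_mul_unrollGhost (e : E.Edge) :
    vert R (E.unroll v) (E.r e) * unrollGhost R hv e = unrollGhost R hv e := by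
  by_cases h : E.r e = v
  · rw [unrollGhost_of_eq hv h, Finset.mul_sum, h]
    refine Finset.sum_congr rfl fun g _ => ?_
    have := vert_mul_edge (R := R) (E := E.unroll v) (.inl ⟨g, hv g g.2⟩)
    simp only [Sum.elim_inl, g.2] at this
    rw [← mul_assoc, this]
  · rw [unrollGhost_of_ne hv h]
    exact vert_mul_ghost (E := E.unroll v) (.inl ⟨e, h⟩)

/-- The inner factors `g* g'` are orthogonal, so only the diagonal terms `(eg) r(g) (eg)*` remain;
this is the second sum in `vert_unroll`. -/
theorem unrollEdge_mul_unrollGhost {e : E.Edge} (h : E.r e = v) :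
    unrollEdge R hv e * unrollGhost R hv e = ∑ g : {g // E.s g = v},
      edge R (E.unroll v) (.inr (⟨e, h⟩, g)) * ghost R (E.unroll v) (.inr (⟨e, h⟩, g)) := by
  classical
  rw [unrollGhost_of_eq hv h, unrollEdge_of_eq hv h, Finset.sum_mul_sum]
  refine Finset.sum_congr rfl fun g _ => ?_
  rw [Finset.sum_eq_single g]
  · rw [mul_assoc, ← mul_assoc (ghost _ _ _), ghost_mul_edge_self]
    exact congrArg _ (vert_mul_ghost (E := E.unroll v) (.inr (⟨e, h⟩, g)))
  · intro g' _ hg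
    rw [mul_assoc, ← mul_assoc (ghost _ _ _), ghost_mul_edge_ne, zero_mul, mul_zero]
    simpa [Subtype.ext_iff] using hg.symm
  · simp

theorem sum_edge_split {A : Type*} [AddCommMonoid A] (v : E.Vertex) (F : E.Edge → A) :
    ∑ e, F e = (∑ e : {e // E.r e ≠ v}, F e) + ∑ e : {e // E.r e = v}, F e := by
  rw [add_comm]
  exact (Fintype.sum_subtype_add_sum_subtype (fun e => E.r e = v) F).symm

/-- The family in the algebra of the unrolled graph. -/
noncomputable def toUnroll (R : Type w) [CommRing R] (hv : ∀ e, E.s e = v → E.r e ≠ v)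
    (hE : E.IsFinite) (hEs : E.NoSinks) :
    Family E (LeavittPathAlgebra R (E.unroll v)) where
  p a := vert R (E.unroll v) a
  a := unrollEdge R hv
  b := unrollGhost R hv
  b_mul_a_self := unrollGhost_mul_self hv hE hEs
  b_mul_a_ne _ _ := unrollGhost_mul_ne hv
  a_mul_p := unrollEdge_mul_vert hv
  p_mul_b := vert_mul_unrollGhost hv
  p_eq_sum a s hs := by
    classical
    have : s = Finset.univ.filter fun e => E.s e = a := by
      ext e
      simp [hs]
    rw [this, Finset.sum_filter, sum_edge_split v, vert_unroll hE hEs]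
    congr 1
    · refine Finset.sum_congr rfl fun e _ => ?_
      rw [unrollEdge_of_ne hv e.2, unrollGhost_of_ne hv e.2]
    · refine Finset.sum_congr rfl fun e _ => ?_
      rw [unrollEdge_mul_unrollGhost hv e.2]

/-- The family of the unrolled graph in the algebra of the original graph. -/
noncomputable def ofUnroll (R : Type w) [CommRing R] (v : E.Vertex)
    (hE : E.IsFinite) (hEs : E.NoSinks) :
    Family (E.unroll v) (LeavittPathAlgebra R E) where
  p a := vert R E a
  a := Sum.elim (fun e => edge R E e) fun x => edge R E x.1 * edge R E x.2
  b := Sum.elim (fun e => ghost R E e) fun x => ghost R E x.2 * ghost R E x.1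
  b_mul_a_self := by
    rintro (e | ⟨⟨e, he⟩, ⟨g, hg⟩⟩)
    · exact ghost_mul_edge_self _
    · simp only [Sum.elim_inr]
      rw [mul_assoc, ← mul_assoc (ghost R E e), ghost_mul_edge_self, he, ← hg, vert_mul_edge,
        ghost_mul_edge_self]
  b_mul_a_ne := by
    rintro (e | ⟨⟨e, he⟩, ⟨g, hg⟩⟩) (f | ⟨⟨f, hf⟩, ⟨h, hh⟩⟩) hne
    · exact ghost_mul_edge_ne fun h => hne (congrArg _ (Subtype.ext h))
    · simp only [Sum.elim_inl, Sum.elim_inr]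
      rw [← mul_assoc, ghost_mul_edge_ne, zero_mul]
      rintro rfl
      exact e.2 hf
    · simp only [Sum.elim_inl, Sum.elim_inr]
      rw [mul_assoc, ghost_mul_edge_ne, mul_zero]
      rintro rfl
      exact f.2 he
    · simp only [Sum.elim_inr]
      by_cases hef : e = f
      · subst hef
        rw [mul_assoc, ← mul_assoc (ghost R E e), ghost_mul_edge_self, he, ← hh, vert_mul_edge,
          ghost_mul_edge_ne]
        rintro rfl
        exact hne rfl
      · rw [mul_assoc, ← mul_assoc (ghost R E e), ghost_mul_edge_ne hef, zero_mul, mul_zero]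
  a_mul_p := by
    rintro (e | ⟨e, g⟩)
    · exact edge_mul_vert _
    · simp only [Sum.elim_inr]
      rw [mul_assoc, edge_mul_vert]
  p_mul_b := by
    rintro (e | ⟨e, g⟩)
    · exact vert_mul_ghost _
    · simp only [Sum.elim_inr]
      rw [← mul_assoc, vert_mul_ghost]
  p_eq_sum a s hs := by
    classical
    have : s = Finset.univ.filter fun e => (E.unroll v).s e = a := by
      ext e
      simp [hs]
    rw [this, Finset.sum_filter, Fintype.sum_sum_type, Fintype.sum_prod_type,
      vert_eq_sum_ite hE hEs, sum_edge_split v]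
    congr 1
    refine Finset.sum_congr rfl fun e _ => ?_
    by_cases h : E.s e = a
    · have hg (g : {g // E.s g = v}) : edge R E e * edge R E g * (ghost R E g * ghost R E e) =
          edge R E e * ((edge R E g * ghost R E g) * ghost R E e) := by
        simp only [mul_assoc]
      have hr := vert_mul_ghost (R := R) e.1
      -- Inserting `v = ∑ gg*` between `e` and `e*` turns `ee*` into `∑ (eg)(eg)*`.
      rw [e.2, vert_eq_sum_subtype hE hEs] at hr
      rw [if_pos h]
      conv_lhs => rw [← hr, Finset.sum_mul, Finset.mul_sum]
      exact Finset.sum_congr rfl fun g _ => (hg g).symm.trans (if_pos h).symm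
    · rw [if_neg h]
      exact (Finset.sum_eq_zero fun g _ => if_neg h).symm

end families

/-- Unrolling the edges into a vertex without loops does not change the Leavitt path algebra. -/
theorem algIsomorphic_unroll (hE : E.IsFinite) (hEs : E.NoSinks) {v : E.Vertex}
    (hv : ∀ e, E.s e = v → E.r e ≠ v) :
    AlgIsomorphic R (LeavittPathAlgebra R E) (LeavittPathAlgebra R (E.unroll v)) := by
  classical
  have := hE.2
  have := Fintype.ofFinite E.Edge
  have hG := unroll_isFinite hE v
  refine algIsomorphic_of_families hE hEs hG (unroll_noSinks hEs v)
    (toUnroll R hv hE hEs) (ofUnroll R v hE hEs) (fun e => ?_) (fun e => ?_) ?_ ?_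
  · by_cases h : E.r e = v
    · simp only [toUnroll, unrollEdge_of_eq hv h, map_sum, map_mul, Family.lift_edge,
        Family.lift_ghost]
      simp only [ofUnroll, Sum.elim_inl, Sum.elim_inr, mul_assoc]
      -- Back in `E` the image is `∑ e g g* = e v = e`.
      rw [← Finset.mul_sum, ← vert_eq_sum_subtype hE hEs, ← h, edge_mul_vert]
    · simp [toUnroll, unrollEdge_of_ne hv h, ofUnroll]
  · by_cases h : E.r e = v
    · simp only [toUnroll, unrollGhost_of_eq hv h, map_sum, map_mul, Family.lift_edge,
        Family.lift_ghost]
      simp only [ofUnroll, Sum.elim_inl, Sum.elim_inr, ← mul_assoc]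
      rw [← Finset.sum_mul, ← vert_eq_sum_subtype hE hEs, ← h, vert_mul_ghost]
    · simp [toUnroll, unrollGhost_of_ne hv h, ofUnroll]
  · rintro (e | ⟨e, g⟩)
    · simp [toUnroll, unrollEdge_of_ne hv e.2, ofUnroll]
    · simp only [ofUnroll, Sum.elim_inr, map_mul, Family.lift_edge]
      simp only [toUnroll]
      rw [unrollEdge_of_eq hv e.2, unrollEdge_of_ne hv (hv g g.2), Finset.sum_mul,
        Finset.sum_eq_single g]
      · rw [mul_assoc, ghost_mul_edge_self]
        exact edge_mul_vert (E := E.unroll v) (.inr (e, g))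
      · intro g' _ hg
        rw [mul_assoc, ghost_mul_edge_ne, mul_zero]
        simpa [Subtype.ext_iff] using hg
      · simp
  · rintro (e | ⟨e, g⟩)
    · simp [toUnroll, unrollGhost_of_ne hv e.2, ofUnroll]
    · simp only [ofUnroll, Sum.elim_inr, map_mul, Family.lift_ghost]
      simp only [toUnroll]
      rw [unrollGhost_of_eq hv e.2, unrollGhost_of_ne hv (hv g g.2), Finset.mul_sum,
        Finset.sum_eq_single g]
      · rw [← mul_assoc, ghost_mul_edge_self]
        exact vert_mul_ghost (E := E.unroll v) (.inr (e, g))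
      · intro g' _ hg
        rw [← mul_assoc, ghost_mul_edge_ne, zero_mul]
        simpa [Subtype.ext_iff] using hg.symm
      · simp

end LeavittPathAlgebra
-- Elimination of sources
namespace LeavittPathAlgebra

variable {R : Type w} [CommRing R]

/-- A finite graph without sinks, each of whose sources emits a single edge, is redirected to a
graph without sources as long as the ranges of these edges receive edges from non-sources. -/
theorem exists_noSources_of_redirect (n : ℕ) (E : DirectedGraph.{u, v}) (hE : E.IsFinite)
    (hEs : E.NoSinks) (hn : {a | E.IsSource a}.ncard = n)
    (h : ∀ a, E.IsSource a → ∃ e₀ f, E.s e₀ = a ∧ (∀ e, E.s e = a → e = e₀) ∧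
      E.r f = E.r e₀ ∧ ¬ E.IsSource (E.s f)) :
    ∃ G : DirectedGraph.{u, v}, G.IsFinite ∧ G.NoSinks ∧ G.NoSources ∧
      AlgIsomorphic R (LeavittPathAlgebra R E) (LeavittPathAlgebra R G) := by
  induction n generalizing E with
  | zero =>
    have := hE.1
    rw [Set.ncard_eq_zero (Set.toFinite _)] at hn
    exact ⟨E, hE, hEs, fun a ha => (hn ▸ (show a ∈ {a | E.IsSource a} from ha) : a ∈ ∅),
      NonUnitalAlgHom.id R _, Function.bijective_id⟩
  | succ n ih =>
    have := hE.1
    obtain ⟨a, ha⟩ : {a | E.IsSource a}.Nonempty := by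
      rw [← Set.ncard_pos (Set.toFinite _)]
      omega
    obtain ⟨e₀, f, rfl, hu, hr, hf⟩ := h a ha
    have hf₀ : f ≠ e₀ := by
      rintro rfl
      exact hf ha
    have hsrc (b : E.Vertex) :
        (E.redirect f (E.s e₀)).IsSource b ↔ E.IsSource b ∧ b ≠ E.s e₀ := by
      simp only [DirectedGraph.isSource_iff]
      constructor
      · intro hb
        have hb' : b ≠ E.s e₀ := by
          rintro rfl
          exact hb f (redirect_r_self ..)
        refine ⟨fun e he => ?_, hb'⟩
        -- If `b` has lost the incoming edge `f`, it still receives `e₀`, which had the same range;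
        -- hence no new source appears.
        by_cases hef : e = f
        · subst hef
          exact hb e₀ ((redirect_r_ne hf₀.symm _).trans (hr.symm.trans he))
        · exact hb e ((redirect_r_ne hef _).trans he)
      · rintro ⟨hb, hb'⟩ e he
        change E.Edge at e
        by_cases hef : e = f
        · subst hef
          exact hb' (he.symm.trans (redirect_r_self e (E.s e₀)))
        · exact hb e ((redirect_r_ne hef (E.s e₀)).symm.trans he)
    have hiso := algIsomorphic_redirect (R := R) hE hEs hu hf₀ hr
    obtain ⟨G, hG, hGs, hGr, hEG⟩ := ih (E.redirect f (E.s e₀)) hE hEs (by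
      have : {b | (E.redirect f (E.s e₀)).IsSource b} = {b | E.IsSource b} \ {E.s e₀} := by
        ext b
        simp [hsrc]
      rw [this, Set.ncard_sdiff_singleton_of_mem ha, hn]
      rfl) (by
      intro b hb
      have hbE := ((hsrc b).1 hb).1
      obtain ⟨e₁, f₁, rfl, hu₁, hr₁, hf₁⟩ := h b hbE
      have he₁ : e₁ ≠ f := by
        rintro rfl
        exact hf hbE
      -- If `f` also served the source `s(e₁)`, it no longer ends at `r(e₁)`. The edge `e₀` takes
      -- its place: it has that range, and its source now receives `f`.
      by_cases hff : f₁ = f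
      · subst hff
        refine ⟨e₁, e₀, rfl, hu₁, ?_, fun h => ((hsrc _).1 h).2 rfl⟩
        rw [redirect_r_ne he₁, redirect_r_ne hf₀.symm, ← hr₁, hr]
      · refine ⟨e₁, f₁, rfl, hu₁, ?_, fun h => hf₁ ((hsrc _).1 h).1⟩
        rw [redirect_r_ne he₁, redirect_r_ne hff, hr₁])
    exact ⟨G, hG, hGs, hGr, AlgIsomorphic_trans hiso hEG⟩

/-- In the split graph of a graph all of whose non-sources carry loops, the sources satisfy the
assumptions for redirecting. -/
theorem splitSources_isSource {E : DirectedGraph.{u, v}}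
    (hl : ∀ a, ¬ E.IsSource a → ∃ e, E.s e = a ∧ E.r e = a) (a : E.splitSources.Vertex)
    (ha : E.splitSources.IsSource a) :
    ∃ e₀ f, E.splitSources.s e₀ = a ∧ (∀ e, E.splitSources.s e = a → e = e₀) ∧
      E.splitSources.r f = E.splitSources.r e₀ ∧
      ¬ E.splitSources.IsSource (E.splitSources.s f) := by
  have hloop (b : E.Vertex) (hb : ¬ E.IsSource b) : ∃ f : E.Edge,
      E.splitSources.r f = .inl ⟨b, hb⟩ ∧ E.splitSources.s f = .inl ⟨b, hb⟩ := by
    obtain ⟨f, hfs, hfr⟩ := hl b hb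
    exact ⟨f, congrArg Sum.inl (Subtype.ext hfr), splitSources_s_eq_inl.2 hfs⟩
  obtain ⟨b, hb⟩ | e₀ := a
  -- A retained vertex receives its loop and is not a source, so only the split vertices occur.
  · obtain ⟨f, hfr, -⟩ := hloop b hb
    exact absurd hfr (DirectedGraph.isSource_iff.1 ha f)
  · obtain ⟨f, hfr, hfs⟩ := hloop (E.r e₀) (DirectedGraph.not_isSource_iff.2 ⟨e₀, rfl⟩)
    exact ⟨e₀.1, f, splitSources_s_eq_inr.2 rfl, fun e he => splitSources_s_eq_inr.1 he, hfr,
      DirectedGraph.not_isSource_iff.2 ⟨f, hfr.trans hfs.symm⟩⟩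

/-- Every composed edge `eg` ends at `r(g)`, which differs from `v` since `g` is not a loop. Thus
`v` turns into a source while old sources persist, which makes the count in `exists_loops` drop. -/
theorem unroll_isSource {E : DirectedGraph.{u, v}} {v : E.Vertex}
    (hv : ∀ e, E.s e = v → E.r e ≠ v) (a : E.Vertex) (ha : E.IsSource a ∨ a = v) :
    (E.unroll v).IsSource a := by
  rw [DirectedGraph.isSource_iff] at ha ⊢
  rintro (e | ⟨e, g⟩) h
  · rcases ha with ha | rfl
    · exact ha _ h
    · exact e.2 h
  · rcases ha with ha | rfl
    · exact ha _ h
    · exact hv _ g.2 h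

/-- Every finite graph without sinks can be unrolled to one in which every vertex that is not a
source carries a loop. -/
theorem exists_loops (n : ℕ) (E : DirectedGraph.{u, v}) (hE : E.IsFinite) (hEs : E.NoSinks)
    (hn : {a | ¬ E.IsSource a ∧ ∀ e, E.s e = a → E.r e ≠ a}.ncard = n) :
    ∃ G : DirectedGraph.{u, v}, G.IsFinite ∧ G.NoSinks ∧
      (∀ a, ¬ G.IsSource a → ∃ e, G.s e = a ∧ G.r e = a) ∧
      AlgIsomorphic R (LeavittPathAlgebra R E) (LeavittPathAlgebra R G) := by
  induction n using Nat.strong_induction_on generalizing E with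
  | _ n ih =>
    have := hE.1
    by_cases h : ∃ v, ¬ E.IsSource v ∧ ∀ e, E.s e = v → E.r e ≠ v
    · obtain ⟨v, hvs, hv⟩ := h
      obtain ⟨G, hG, hGs, hGl, hEG⟩ := ih _ (by
        rw [← hn]
        -- Loops at vertices other than `v` survive unrolling, so no loopless non-source is created,
        -- and `v` itself leaves the set.
        refine Set.ncard_lt_ncard ⟨?_, fun hsub => ?_⟩ (Set.toFinite _)
        · rintro a ⟨ha, hl⟩
          have hav : a ≠ v := fun h => ha (unroll_isSource hv a (.inr h))
          refine ⟨fun h => ha (unroll_isSource hv a (.inl h)), fun e he her => ?_⟩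
          exact hl (.inl ⟨e, her.trans_ne hav⟩) he her
        · exact (hsub (show v ∈ {a | ¬ E.IsSource a ∧ ∀ e, E.s e = a → E.r e ≠ a} from
            ⟨hvs, hv⟩)).1 (unroll_isSource hv v (.inr rfl)))
        (E.unroll v) (unroll_isFinite hE v) (unroll_noSinks hEs v) rfl
      exact ⟨G, hG, hGs, hGl, AlgIsomorphic_trans (algIsomorphic_unroll hE hEs hv) hEG⟩
    · push Not at h
      exact ⟨E, hE, hEs, h, NonUnitalAlgHom.id R _, Function.bijective_id⟩

end LeavittPathAlgebra

theorem mainTheorem9 (R : Type w) [CommRing R] (E : DirectedGraph.{u, v})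
    (hfin : E.IsFinite) (hsink : E.NoSinks) :
    (∃ G : DirectedGraph.{0, 0}, G.IsFinite ∧ G.NoSinks ∧ G.NoSources ∧
      AlgIsomorphic R (LeavittPathAlgebra R E) (LeavittPathAlgebra R G)) ∧
    IsAlgebraicCuntzKrieger R (LeavittPathAlgebra R E) := by
  rw [IsAlgebraicCuntzKrieger, and_self]
  have := hfin.1
  have := hfin.2
  -- Relabelling by `Fin n` and `Fin m` brings the graph into the universe required of `G`.
  obtain ⟨n, ⟨α⟩⟩ := Finite.exists_equiv_fin E.Vertex
  obtain ⟨m, ⟨β⟩⟩ := Finite.exists_equiv_fin E.Edge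
  let E₁ : DirectedGraph.{0, 0} :=
    ⟨Fin n, Fin m, fun e => α (E.s (β.symm e)), fun e => α (E.r (β.symm e))⟩
  have hE₁ : E₁.IsFinite := ⟨inferInstanceAs (Finite (Fin n)), inferInstanceAs (Finite (Fin m))⟩
  have hE₁s : E₁.NoSinks := by
    rw [DirectedGraph.noSinks_iff] at hsink ⊢
    intro a
    obtain ⟨e, he⟩ := hsink (α.symm a)
    exact ⟨β e, by simp [E₁, he]⟩
  obtain ⟨E₂, hE₂, hE₂s, hl, h₂⟩ := LeavittPathAlgebra.exists_loops (R := R) _ E₁ hE₁ hE₁s rfl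
  obtain ⟨G, hG, hGs, hGr, h₃⟩ := LeavittPathAlgebra.exists_noSources_of_redirect (R := R) _
    E₂.splitSources (LeavittPathAlgebra.splitSources_isFinite hE₂)
    (LeavittPathAlgebra.splitSources_noSinks hE₂s) rfl
    (LeavittPathAlgebra.splitSources_isSource hl)
  have h₁ : AlgIsomorphic R (LeavittPathAlgebra R E) (LeavittPathAlgebra R E₁) :=
    LeavittPathAlgebra.algIsomorphic_of_relabel hfin hsink hE₁ hE₁s α β
      (fun e => by simp [E₁]) (fun e => by simp [E₁])
  exact ⟨G, hG, hGs, hGr, LeavittPathAlgebra.AlgIsomorphic_trans h₁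
    (LeavittPathAlgebra.AlgIsomorphic_trans h₂
      (LeavittPathAlgebra.AlgIsomorphic_trans
        (LeavittPathAlgebra.algIsomorphic_splitSources hE₂ hE₂s) h₃))⟩
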